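/- Let $m=(m_k)_{k\ge 0}$ be a bounded sequence of integers $m_k\ge 2$, put $M_0=1$, $M_{k+1}=m_kM_k$, and let $G_m=\prod_{k\ge0}\mathbb{Z}/m_k\mathbb{Z}$ be the corresponding Vilenkin group, with coordinates $x_k\in\{0,\dots,m_k-1\}$ and normalised Haar measure $\mu$; $\|\cdot\|_p$ is the norm of $L^p(G_m)=L^p(G_m,\mu)$ (complex-valued functions). For $n=\sum_k n_kM_k$ with $0\le n_k<m_k$ let $\psi_n(x)=\prod_k \exp(2\pi i\,n_kx_k/m_k)$, and for $f\in L^1(G_m)$ let $\widehat f(k)=\int_{G_m} f\,\overline{\psi_k}\,d\mu$ and $S_nf=\sum_{k=0}^{n-1}\widehat f(k)\psi_k$ (with $S_0f=0$). For a sequence $(q_k)_{k\ge0}$ put $Q_n=\sum_{k=0}^{n-1}q_k$ and $T_nf=\frac1{Q_n}\sum_{k=0}^{n-1}q_kS_kf$. With $|x|=\sum_{k\ge0}x_k/M_{k+1}$ let $\omega_p(\delta,f)=\sup_{|t|<\delta}\|f(\cdot-t)-f\|_p$, and let $\mathrm{Lip}(\alpha,p)$ be the set of $f\in L^p(G_m)$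 with $\omega_p(\delta,f)=O(\delta^\alpha)$ as $\delta\to0^+$. Let $(q_k)_{k\ge0}$ be non-negative and non-increasing with $q_k\asymp k^{-\beta}$ as $k\to\infty$ for some $0<\beta\le1$. If $f\in\mathrm{Lip}(\alpha,p)$ for some $\alpha>0$ and $1\le p<\infty$, then, as $n\to\infty$, $$\|T_nf-f\|_p=\begin{cases}O(n^{-\alpha}) & \text{if }\alpha+\beta<1,\\ O(n^{-(1-\beta)}\log n+n^{-\alpha}) & \text{if }\alpha+\beta=1,\\ O(n^{-(1-\beta)}) & \text{if }\alpha+\beta>1,\ \beta<1,\\ O((\log n)^{-1}) & \text{if }\beta=1.\end{cases}$$ -/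

import Mathlib

open MeasureTheory Filter Topology
open scoped ENNReal

namespace Vilenkin

/-- The Vilenkin group `G_m`: the complete direct product of the cyclic groups `ℤ / m_k`, with
coordinatewise addition and the product topology and `σ`-algebra. -/
abbrev G (m : ℕ → ℕ) : Type := ∀ k : ℕ, ZMod (m k)

/-- The normalised Haar measure: the direct product of the uniform probability measures on the
groups `ℤ / m_k`. -/
noncomputable def μ (m : ℕ → ℕ) [∀ k, NeZero (m k)] : Measure (G m) :=
  Measure.infinitePi fun k => (PMF.uniformOfFintype (ZMod (m k))).toMeasure

/-- The generalised powers `M_0 = 1`, `M_{k+1} = m_k M_k`. -/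
def M (m : ℕ → ℕ) : ℕ → ℕ
  | 0 => 1
  | k + 1 => m k * M m k

/-- The `k`-th digit of `n` in the number system generated by `m`. -/
def digit (m : ℕ → ℕ) (n k : ℕ) : ℕ := n / M m k % m k

/-- The generalised Rademacher functions `r_k(x) = exp(2πi x_k / m_k)`, where the coordinate `x_k`
is represented in `{0, …, m_k - 1}`. -/
noncomputable def rademacher (m : ℕ → ℕ) (k : ℕ) (x : G m) : ℂ :=
  Complex.exp (2 * Real.pi * Complex.I * ((x k).val : ℂ) / (m k : ℂ))

/-- The Vilenkin functions `ψ_n = ∏_k r_k ^ n_k`. When all `m_k ≥ 2`, the digits `n_k` with `n ≤ k`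
vanish (see `digit_eq_zero`), so this is the full product over all `k`. -/
noncomputable def ψ (m : ℕ → ℕ) (n : ℕ) (x : G m) : ℂ :=
  ∏ k ∈ Finset.range n, rademacher m k x ^ digit m n k

theorem lt_M {m : ℕ → ℕ} (hm : ∀ k, 2 ≤ m k) (k : ℕ) : k < M m k := by
  induction k with
  | zero => simp [M]
  | succ k ih =>
    have h := Nat.mul_le_mul (hm k) (Nat.succ_le_of_lt ih)
    simp only [M]
    omega

theorem digit_eq_zero {m : ℕ → ℕ} (hm : ∀ k, 2 ≤ m k) {n k : ℕ} (h : n ≤ k) :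
    digit m n k = 0 := by
  have : n / M m k = 0 := Nat.div_eq_of_lt (lt_of_le_of_lt h (lt_M hm k))
  simp [digit, this]

section
variable (m : ℕ → ℕ) [∀ k, NeZero (m k)]

/-- The Vilenkin-Fourier coefficients of `f`. -/
noncomputable def coeff (f : G m → ℂ) (k : ℕ) : ℂ :=
  ∫ x, f x * (starRingEnd ℂ) (ψ m k x) ∂(μ m)

/-- The partial sums `S_n f` of the Vilenkin-Fourier series (with `S_0 f = 0`). -/
noncomputable def S (f : G m → ℂ) (n : ℕ) (x : G m) : ℂ :=
  ∑ k ∈ Finset.range n, coeff m f k * ψ m k x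

/-- The `T` means `T_n f = (1 / Q_n) ∑_{k < n} q_k S_k f`, where `Q_n = ∑_{k < n} q_k`. -/
noncomputable def T (q : ℕ → ℝ) (f : G m → ℂ) (n : ℕ) (x : G m) : ℂ :=
  ((∑ k ∈ Finset.range n, q k : ℝ) : ℂ)⁻¹ * ∑ k ∈ Finset.range n, (q k : ℂ) * S m f k x

/-- The size `|x| = ∑_k x_k / M_{k+1}` of an element of the Vilenkin group. -/
noncomputable def size (x : G m) : ℝ := ∑' k, ((x k).val : ℝ) / (M m (k + 1) : ℝ)

/-- The `L^p` modulus of continuity `ω_p(δ, f) = sup_{|t| < δ} ‖f(· - t) - f‖_p`. -/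
noncomputable def modulus (p : ℝ≥0∞) (δ : ℝ) (f : G m → ℂ) : ℝ≥0∞ :=
  ⨆ (t : G m) (_ : size m t < δ), eLpNorm (fun x => f (x - t) - f x) p (μ m)

/-- `f ∈ Lip(α, p)`: `f ∈ L^p` and `ω_p(δ, f) = O(δ^α)` as `δ → 0+`. -/
def Lip (α : ℝ) (p : ℝ≥0∞) (f : G m → ℂ) : Prop :=
  MemLp f p (μ m) ∧
    ∃ C : ℝ, ∀ᶠ δ in 𝓝[>] (0 : ℝ), modulus m p δ f ≤ ENNReal.ofReal (C * δ ^ α)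

end

end Vilenkin

/-! Since $T_nf-f=Q_n^{-1}\sum_{k<n}q_k(S_kf-f)$, the task is to bound a weighted sum from above and
$Q_n$ from below. The sum is cut into the blocks $M_j\le k<M_{j+1}$. As $q$ is non-increasing,
Abel's inequality bounds each block by $q_{M_j}$ times the largest norm of an unweighted sum of
$S_kf-f$ starting at $M_j$.

On the block $S_kf-f=S_kg-g$ with $g=f-S_{M_j}f$, so the unweighted sum is $g$ convolved with a
difference of unnormalised Fejér kernels, minus a multiple of $g$. Two facts bound it by
$O(M_j^{1-\alpha})$ (`eLpNorm_sum_S_sub_le`): on a bounded Vilenkin group these kernels have $L^1$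
norm $O(M_j)$ (`integral_norm_fejer_le`), and $D_{M_j}$ is an averaging kernel supported where
$x_0=\dots=x_{j-1}=0$, so $\|g\|_p=O(M_j^{-\alpha})$ (`eLpNorm_sub_S_le`, `Lip.exists_bound`).

Since $q_{M_j}=O(M_j^{-\beta})$, the weighted sum is $O(1+\sum_j M_j^{1-\alpha-\beta})$ over the
blocks met by $[1,n]$ (`Lip.exists_eLpNorm_sum_le`). As $M_j$ at least doubles, the sign of
$1-\alpha-\beta$ decides whether the last block dominates, all blocks count equally, or the sum
stays bounded. Division by $Q_n\ge cn^{1-\beta}$, or $Q_n\ge c\log n$ when $\beta=1$, gives the four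
rates. -/

/-! ### Convolution estimates in $L^p$. -/

/-- **Minkowski's integral inequality** for a superposition of functions whose `L^p` norms are
uniformly bounded. -/
theorem MeasureTheory.eLpNorm_integral_mul_le {X Y : Type*} [MeasurableSpace X] [MeasurableSpace Y]
    {μ : Measure X} {ν : Measure Y} [SFinite μ] [SFinite ν] {p : ℝ≥0∞} (hp : 1 ≤ p) (hp' : p ≠ ∞)
    {h : X × Y → ℂ} (hh : AEStronglyMeasurable h (μ.prod ν)) {K : Y → ℂ} (hK : Measurable K)
    (hK' : Integrable K ν) {B : ℝ≥0∞}
    (hB : ∀ y, K y ≠ 0 → eLpNorm (fun x => h (x, y)) p μ ≤ B) :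
    eLpNorm (fun x => ∫ y, h (x, y) * K y ∂ν) p μ ≤ B * ∫⁻ y, ‖K y‖ₑ ∂ν := by
  -- With $|K|$ absorbed into a finite measure, Hölder on $\rho$ gives a pointwise bound for the
  -- $r$-th power, and Tonelli then integrates it in $x$.
  set ρ : Measure Y := ν.withDensity fun y => ‖K y‖ₑ with hρ
  have hρu : ρ Set.univ = ∫⁻ y, ‖K y‖ₑ ∂ν := by simp [hρ]
  have hρfin : IsFiniteMeasure ρ := ⟨by rw [hρu]; exact hK'.hasFiniteIntegral⟩
  have hp0 : p ≠ 0 := (one_pos.trans_le hp).ne'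
  set r := p.toReal with hr
  have hr1 : 1 ≤ r := by
    rw [hr, ← ENNReal.toReal_one]; exact ENNReal.toReal_mono hp' hp
  have hr0 : 0 < r := by linarith
  have hac : μ.prod ρ ≪ μ.prod ν :=
    Measure.AbsolutelyContinuous.rfl.prod (withDensity_absolutelyContinuous _ _)
  have hhρ : AEStronglyMeasurable h (μ.prod ρ) := hh.mono_ac hac
  have key : ∀ᵐ x ∂μ, ‖∫ y, h (x, y) * K y ∂ν‖ₑ ^ r ≤
      ρ Set.univ ^ (r - 1) * ∫⁻ y, ‖h (x, y)‖ₑ ^ r ∂ρ := by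
    filter_upwards [hhρ.prodMk_left, hh.prodMk_left] with x hx hx'
    have h1 : ‖∫ y, h (x, y) * K y ∂ν‖ₑ ≤ eLpNorm (fun y => h (x, y)) 1 ρ := by
      rw [eLpNorm_one_eq_lintegral_enorm, hρ,
        lintegral_withDensity_eq_lintegral_mul₀ hK.enorm.aemeasurable hx'.enorm]
      refine (enorm_integral_le_lintegral_enorm _).trans_eq (lintegral_congr fun y => ?_)
      rw [enorm_mul, mul_comm]; rfl
    have h2 := h1.trans (eLpNorm_le_eLpNorm_mul_rpow_measure_univ hp hx)
    calc ‖∫ y, h (x, y) * K y ∂ν‖ₑ ^ r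
        ≤ (eLpNorm (fun y => h (x, y)) p ρ * ρ Set.univ ^ (1 - 1 / r)) ^ r := by
          gcongr
          simpa using h2
      _ = _ := by
          rw [ENNReal.mul_rpow_of_nonneg _ _ hr0.le, mul_comm, ← ENNReal.rpow_mul,
            eLpNorm_eq_lintegral_rpow_enorm_toReal hp0 hp', ← ENNReal.rpow_mul, ← hr,
            one_div_mul_cancel hr0.ne', ENNReal.rpow_one]
          congr 2
          field_simp
  have key2 : ∫⁻ x, ‖∫ y, h (x, y) * K y ∂ν‖ₑ ^ r ∂μ ≤ (B * ρ Set.univ) ^ r := by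
    have hm : AEMeasurable (fun z : X × Y => ‖h z‖ₑ ^ r) (μ.prod ρ) := hhρ.enorm.pow_const _
    calc ∫⁻ x, ‖∫ y, h (x, y) * K y ∂ν‖ₑ ^ r ∂μ
        ≤ ∫⁻ x, ρ Set.univ ^ (r - 1) * ∫⁻ y, ‖h (x, y)‖ₑ ^ r ∂ρ ∂μ := lintegral_mono_ae key
      _ = ρ Set.univ ^ (r - 1) * ∫⁻ x, ∫⁻ y, ‖h (x, y)‖ₑ ^ r ∂ρ ∂μ :=
          lintegral_const_mul' _ _ (ENNReal.rpow_ne_top_of_nonneg (by linarith) (measure_ne_top _ _))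
      _ = ρ Set.univ ^ (r - 1) * ∫⁻ y, ∫⁻ x, ‖h (x, y)‖ₑ ^ r ∂μ ∂ρ := by
          rw [lintegral_lintegral_swap hm]
      _ ≤ ρ Set.univ ^ (r - 1) * ∫⁻ _, B ^ r ∂ρ := by
          refine mul_le_mul' le_rfl (lintegral_mono_ae ?_)
          -- Points with $K=0$ are $\rho$-null, so the bound $B$ is needed only on the support of
          -- the kernel.
          have h0 : ∀ᵐ y ∂ρ, K y ≠ 0 := by
            rw [hρ, ae_withDensity_iff hK.enorm]
            exact Eventually.of_forall fun y hy => by simpa using hy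
          filter_upwards [h0] with y hy
          have := hB y hy
          rw [eLpNorm_eq_lintegral_rpow_enorm_toReal hp0 hp', ← hr] at this
          have := ENNReal.rpow_le_rpow this hr0.le
          rwa [← ENNReal.rpow_mul, one_div_mul_cancel hr0.ne', ENNReal.rpow_one] at this
      _ = (B * ρ Set.univ) ^ r := by
          rw [lintegral_const, ENNReal.mul_rpow_of_nonneg _ _ hr0.le, mul_comm, mul_assoc]
          congr 1
          nth_rw 1 [← ENNReal.rpow_one (ρ Set.univ)]
          rw [← ENNReal.rpow_add_of_nonneg _ _ zero_le_one (by linarith)]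
          congr 1; ring
  rw [eLpNorm_eq_lintegral_rpow_enorm_toReal hp0 hp', ← hρu, ← hr]
  calc _ ≤ ((B * ρ Set.univ) ^ r) ^ (1 / r) := by gcongr
    _ = _ := by rw [← ENNReal.rpow_mul, mul_one_div_cancel hr0.ne', ENNReal.rpow_one]

/-! ### Invariance of the product measure. -/

theorem PMF.map_uniformOfFintype_equiv {α : Type*} [Fintype α] [Nonempty α] (e : α ≃ α) :
    (PMF.uniformOfFintype α).map e = PMF.uniformOfFintype α := by
  ext a
  rw [PMF.map_apply, tsum_eq_single (e.symm a)]
  · simp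
  · intro b hb
    rw [if_neg]
    rintro rfl
    simp at hb

namespace Vilenkin

section
variable (m : ℕ → ℕ) [∀ k, NeZero (m k)]

instance isProbabilityMeasure_μ : IsProbabilityMeasure (μ m) := by
  unfold μ; infer_instance

theorem map_μ (e : ∀ k, ZMod (m k) ≃ ZMod (m k)) :
    (μ m).map (fun x k => e k (x k)) = μ m := by
  unfold μ
  rw [Measure.infinitePi_map_pi _ fun k => measurable_of_countable _]
  congr 1
  funext k
  rw [PMF.toMeasure_map _ _ (measurable_of_countable _), PMF.map_uniformOfFintype_equiv]

instance isAddLeftInvariant_μ : (μ m).IsAddLeftInvariant :=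
  ⟨fun g => map_μ m fun k => Equiv.addLeft (g k)⟩

instance isNegInvariant_μ : (μ m).IsNegInvariant :=
  ⟨map_μ m fun k => Equiv.neg (ZMod (m k))⟩

end

/-! ### Digits, Vilenkin functions and kernel recursions. -/

section
variable {m : ℕ → ℕ}

theorem M_pos (hm : ∀ k, 2 ≤ m k) (k : ℕ) : 0 < M m k := (Nat.zero_le k).trans_lt (lt_M hm k)

theorem M_succ_dvd {k j : ℕ} (h : k < j) : M m (k + 1) ∣ M m j := by
  induction j with
  | zero => omega
  | succ j ih =>
    rcases Nat.lt_succ_iff_lt_or_eq.1 h with h | rfl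
    · exact (ih h).trans (Dvd.intro_left _ rfl)
    · exact dvd_rfl

theorem M_mono (hm : ∀ k, 2 ≤ m k) : Monotone (M m) :=
  monotone_nat_of_le_succ fun k => by
    have := hm k
    simp only [M]
    nlinarith [M_pos hm k]

theorem digit_eq_zero_of_lt {n k : ℕ} (h : n < M m k) : digit m n k = 0 := by
  simp [digit, Nat.div_eq_of_lt h]

theorem digit_mul_add_self {i j s : ℕ} (hi : i < M m j) (hs : s < m j) :
    digit m (s * M m j + i) j = s := by
  have h0 : 0 < M m j := (Nat.zero_le i).trans_lt hi
  rw [digit, mul_comm, Nat.mul_add_div h0, Nat.div_eq_of_lt hi, add_zero, Nat.mod_eq_of_lt hs]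

theorem digit_mul_add_of_lt (hm : ∀ k, 2 ≤ m k) {i j s k : ℕ} (hk : k < j) :
    digit m (s * M m j + i) k = digit m i k := by
  obtain ⟨c, hc⟩ := M_succ_dvd (m := m) hk
  have h0 := M_pos hm k
  rw [digit, digit, hc]
  have : s * (M m (k + 1) * c) + i = M m k * (m k * (s * c)) + i := by
    simp only [M]; ring
  rw [this, Nat.mul_add_div h0, Nat.mul_add_mod]

theorem exists_digit_ne (hm : ∀ k, 2 ≤ m k) {j a b : ℕ} (ha : a < M m j) (hb : b < M m j)
    (hab : a ≠ b) : ∃ k < j, digit m a k ≠ digit m b k := by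
  induction j generalizing a b with
  | zero => simp [M] at ha hb; omega
  | succ j ih =>
    have h0 := M_pos hm j
    have key : ∀ c < M m (j + 1), c = c / M m j * M m j + c % M m j ∧ c / M m j < m j ∧
        c % M m j < M m j := fun c hc =>
      ⟨(Nat.div_add_mod' c _).symm, Nat.div_lt_of_lt_mul (by simpa [M, mul_comm] using hc),
        Nat.mod_lt _ h0⟩
    obtain ⟨a1, a2, a3⟩ := key a ha
    obtain ⟨b1, b2, b3⟩ := key b hb
    by_cases hd : a / M m j = b / M m j
    · have hr : a % M m j ≠ b % M m j := fun h => hab (by rw [a1, b1, hd, h])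
      obtain ⟨k, hk, hne⟩ := ih a3 b3 hr
      refine ⟨k, hk.trans (Nat.lt_succ_self j), ?_⟩
      rw [a1, b1, digit_mul_add_of_lt hm hk, digit_mul_add_of_lt hm hk]
      exact hne
    · refine ⟨j, Nat.lt_succ_self j, ?_⟩
      rw [a1, b1, digit_mul_add_self a3 a2, digit_mul_add_self b3 b2]
      exact hd

theorem ψ_eq_prod (hm : ∀ k, 2 ≤ m k) {n j : ℕ} (h : n < M m j) (x : G m) :
    ψ m n x = ∏ k ∈ Finset.range j, rademacher m k x ^ digit m n k := by
  have hn : ∀ k ∉ Finset.range n, rademacher m k x ^ digit m n k = 1 := fun k hk => by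
    rw [digit_eq_zero hm (by simpa using hk), pow_zero]
  have hj : ∀ k ∉ Finset.range j, rademacher m k x ^ digit m n k = 1 := fun k hk => by
    rw [digit_eq_zero_of_lt (h.trans_le (M_mono hm (by simpa using hk))), pow_zero]
  rw [ψ]
  rcases le_total n j with hnj | hnj
  · exact Finset.prod_subset (Finset.range_mono hnj) fun k _ => hn k
  · exact (Finset.prod_subset (Finset.range_mono hnj) fun k _ => hj k).symm

/-- The index $sM_j+i$ has digit $s$ at place $j$ and the digits of $i$ below it. All recursions for
the kernels come from this factorisation. -/
theorem ψ_mul_add (hm : ∀ k, 2 ≤ m k) {i j s : ℕ} (hi : i < M m j) (hs : s < m j) (x : G m) :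
    ψ m (s * M m j + i) x = rademacher m j x ^ s * ψ m i x := by
  have hlt : s * M m j + i < M m (j + 1) := by
    simp only [M]
    calc s * M m j + i < s * M m j + M m j := by omega
      _ = (s + 1) * M m j := by ring
      _ ≤ m j * M m j := Nat.mul_le_mul_right _ hs
  rw [ψ_eq_prod hm hlt, ψ_eq_prod hm hi, Finset.prod_range_succ, digit_mul_add_self hi hs, mul_comm]
  congr 1
  exact Finset.prod_congr rfl fun k hk => by rw [digit_mul_add_of_lt hm (Finset.mem_range.1 hk)]

theorem ψ_zero_index (m : ℕ → ℕ) (x : G m) : ψ m 0 x = 1 := by simp [ψ]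

/-- The Dirichlet kernels `∑_{i < k} ψ_i`. -/
noncomputable def dirichlet (m : ℕ → ℕ) (k : ℕ) (x : G m) : ℂ := ∑ i ∈ Finset.range k, ψ m i x

/-- The unnormalised Fejér kernels `∑_{k < l} D_k`. -/
noncomputable def fejer (m : ℕ → ℕ) (l : ℕ) (x : G m) : ℂ := ∑ k ∈ Finset.range l, dirichlet m k x

theorem dirichlet_mul (hm : ∀ k, 2 ≤ m k) {j s : ℕ} (hs : s ≤ m j) (x : G m) :
    dirichlet m (s * M m j) x =
      (∑ t ∈ Finset.range s, rademacher m j x ^ t) * dirichlet m (M m j) x := by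
  induction s with
  | zero => simp [dirichlet]
  | succ s ih =>
    rw [Nat.succ_mul, dirichlet, Finset.sum_range_add, ← dirichlet, ih (by omega),
      Finset.sum_range_succ, add_mul]
    congr 1
    rw [dirichlet, Finset.mul_sum]
    exact Finset.sum_congr rfl fun i hi => ψ_mul_add hm (Finset.mem_range.1 hi) hs x

theorem dirichlet_mul_add (hm : ∀ k, 2 ≤ m k) {i j s : ℕ} (hi : i ≤ M m j) (hs : s < m j)
    (x : G m) :
    dirichlet m (s * M m j + i) x =
      (∑ t ∈ Finset.range s, rademacher m j x ^ t) * dirichlet m (M m j) x +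
        rademacher m j x ^ s * dirichlet m i x := by
  rw [dirichlet, Finset.sum_range_add, ← dirichlet, dirichlet_mul hm hs.le]
  congr 1
  rw [dirichlet, Finset.mul_sum]
  exact Finset.sum_congr rfl fun k hk =>
    ψ_mul_add hm ((Finset.mem_range.1 hk).trans_le hi) hs x

end

/-! ### Characters, orthogonality and Dirichlet kernels. -/

section
variable (m : ℕ → ℕ) [∀ k, NeZero (m k)]

theorem rademacher_eq (k : ℕ) (x : G m) : rademacher m k x = ZMod.stdAddChar (x k) := by
  rw [rademacher, ZMod.stdAddChar_apply, ZMod.toCircle_apply]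

theorem norm_rademacher (k : ℕ) (x : G m) : ‖rademacher m k x‖ = 1 := by
  rw [rademacher_eq, ZMod.stdAddChar_apply, Circle.norm_coe]

theorem measurable_rademacher (k : ℕ) : Measurable (rademacher m k) := by
  simp_rw [funext (rademacher_eq m k)]
  exact (measurable_of_countable (ZMod.stdAddChar (N := m k))).comp (measurable_pi_apply k)

theorem rademacher_pow_self (k : ℕ) (x : G m) : rademacher m k x ^ m k = 1 := by
  rw [rademacher_eq, ← AddChar.map_nsmul_eq_pow]
  simp

theorem sum_rademacher_pow (k : ℕ) (x : G m) :
    ∑ s ∈ Finset.range (m k), rademacher m k x ^ s = if x k = 0 then (m k : ℂ) else 0 := by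
  split_ifs with h
  · simp [rademacher_eq, h]
  · have h1 : rademacher m k x ≠ 1 := fun h1 => h <| by
      rw [rademacher_eq, ← AddChar.map_zero_eq_one (ZMod.stdAddChar (N := m k))] at h1
      exact ZMod.injective_stdAddChar h1
    rw [geom_sum_eq h1, rademacher_pow_self, sub_self, zero_div]

theorem norm_ψ (n : ℕ) (x : G m) : ‖ψ m n x‖ = 1 := by
  simp [ψ, norm_prod, norm_rademacher]

theorem measurable_ψ (n : ℕ) : Measurable (ψ m n) :=
  Finset.measurable_prod _ fun k _ => (measurable_rademacher m k).pow_const _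

theorem ψ_add (n : ℕ) (x y : G m) : ψ m n (x + y) = ψ m n x * ψ m n y := by
  simp_rw [ψ, ← Finset.prod_mul_distrib, ← mul_pow]
  simp [rademacher_eq, AddChar.map_add_eq_mul]

theorem ψ_mul_conj_sub (n : ℕ) (x t : G m) :
    ψ m n x * (starRingEnd ℂ) (ψ m n (x - t)) = ψ m n t := by
  have h : ψ m n x = ψ m n t * ψ m n (x - t) := by rw [← ψ_add]; simp
  rw [h, mul_assoc, Complex.mul_conj, Complex.normSq_eq_norm_sq, norm_ψ]
  simp

theorem integrable_ψ (n : ℕ) : Integrable (ψ m n) (μ m) :=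
  Integrable.of_bound (measurable_ψ m n).aestronglyMeasurable 1
    (Eventually.of_forall fun x => (norm_ψ m n x).le)

variable {m}

theorem ψ_single (hm : ∀ k, 2 ≤ m k) (n j : ℕ) (a : ZMod (m j)) :
    ψ m n (Pi.single j a) = ZMod.stdAddChar a ^ digit m n j := by
  obtain ⟨J, hJn, hJj⟩ : ∃ J, n < M m J ∧ j < J :=
    ⟨max n j + 1, (lt_M hm n).trans_le (M_mono hm (by omega)), by omega⟩
  rw [ψ_eq_prod hm hJn, Finset.prod_eq_single j]
  · simp [rademacher_eq]
  · intro k _ hk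
    simp [rademacher_eq, Pi.single_eq_of_ne hk]
  · simp [hJj]

/-- For $a\ne b$, translation by the unit vector at a place where the digits differ multiplies the
integrand by a constant $c\neq1$ but preserves the integral, which must vanish. -/
theorem integral_ψ_mul_conj (hm : ∀ k, 2 ≤ m k) (a b : ℕ) :
    ∫ x, ψ m a x * (starRingEnd ℂ) (ψ m b x) ∂μ m = if a = b then 1 else 0 := by
  split_ifs with h
  · subst h
    simp [Complex.mul_conj, Complex.normSq_eq_norm_sq, norm_ψ]
  · obtain ⟨j, -, hj⟩ := exists_digit_ne hm (j := max a b)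
      ((lt_M hm a).trans_le (M_mono hm (le_max_left a b)))
      ((lt_M hm b).trans_le (M_mono hm (le_max_right a b))) h
    set e : G m := Pi.single j 1 with he
    set c : ℂ := ψ m a e * (starRingEnd ℂ) (ψ m b e) with hc
    have hc1 : c ≠ 1 := by
      intro h1
      have h2 : ψ m a e = ψ m b e := by
        have := congrArg (· * ψ m b e) h1
        simp only [hc, one_mul, mul_assoc] at this
        rwa [mul_comm ((starRingEnd ℂ) _), Complex.mul_conj, Complex.normSq_eq_norm_sq, norm_ψ,
          one_pow, Complex.ofReal_one, mul_one] at this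
      rw [he, ψ_single hm, ψ_single hm, ← AddChar.map_nsmul_eq_pow, ← AddChar.map_nsmul_eq_pow] at h2
      have h3 := ZMod.injective_stdAddChar h2
      have h4 := congrArg ZMod.val h3
      simp only [nsmul_eq_mul, mul_one, ZMod.val_natCast] at h4
      simp only [digit, Nat.mod_mod] at h4
      exact hj h4
    have hI := integral_add_left_eq_self (μ := μ m)
      (fun x => ψ m a x * (starRingEnd ℂ) (ψ m b x)) e
    have hI' : ∀ x, ψ m a (e + x) * (starRingEnd ℂ) (ψ m b (e + x)) =
        c * (ψ m a x * (starRingEnd ℂ) (ψ m b x)) := fun x => by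
      rw [ψ_add, ψ_add, map_mul, hc]; ring
    simp_rw [hI', integral_const_mul] at hI
    by_contra h0
    exact hc1 (mul_right_cancel₀ h0 (hI.trans (one_mul _).symm))

variable (m)

theorem measurable_dirichlet (k : ℕ) : Measurable (dirichlet m k) :=
  Finset.measurable_sum _ fun i _ => measurable_ψ m i

theorem measurable_fejer (l : ℕ) : Measurable (fejer m l) :=
  Finset.measurable_sum _ fun k _ => measurable_dirichlet m k

theorem integrable_dirichlet (k : ℕ) : Integrable (dirichlet m k) (μ m) :=
  integrable_finsetSum _ fun i _ => integrable_ψ m i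

theorem integrable_fejer (l : ℕ) : Integrable (fejer m l) (μ m) :=
  integrable_finsetSum _ fun k _ => integrable_dirichlet m k

variable {m}

theorem ψ_add_single (hm : ∀ k, 2 ≤ m k) {n j : ℕ} (hn : n < M m j) (a : ZMod (m j)) (x : G m) :
    ψ m n (Pi.single j a + x) = ψ m n x := by
  rw [ψ_add, ψ_single hm, digit_eq_zero_of_lt hn, pow_zero, one_mul]

theorem fejer_add_single (hm : ∀ k, 2 ≤ m k) {j : ℕ} (a : ZMod (m j)) (x : G m) :
    fejer m (M m j) (Pi.single j a + x) = fejer m (M m j) x := by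
  refine Finset.sum_congr rfl fun k hk => Finset.sum_congr rfl fun i hi => ?_
  simp only [Finset.mem_range] at hk hi
  exact ψ_add_single hm (hi.trans hk) a x

/-- Passing from $M_j$ to $M_{j+1}$ multiplies the kernel by a full geometric sum of an $m_j$-th
root of unity, which is $m_j$ or $0$. -/
theorem dirichlet_M (hm : ∀ k, 2 ≤ m k) (j : ℕ) (x : G m) :
    dirichlet m (M m j) x = if ∀ k < j, x k = 0 then (M m j : ℂ) else 0 := by
  induction j with
  | zero => simp [dirichlet, M, ψ_zero_index]
  | succ j ih =>
    rw [M, dirichlet_mul hm le_rfl, sum_rademacher_pow, ih]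
    simp only [Nat.forall_lt_succ_right]
    by_cases h1 : x j = 0 <;> by_cases h2 : ∀ k < j, x k = 0 <;> simp [h1, h2]

theorem integral_dirichlet (hm : ∀ k, 2 ≤ m k) {k : ℕ} (hk : 0 < k) :
    ∫ x, dirichlet m k x ∂μ m = 1 := by
  unfold dirichlet
  rw [integral_finsetSum _ fun i _ => integrable_ψ m i, Finset.sum_eq_single 0]
  · simp [ψ_zero_index]
  · intro i _ hi
    simpa [ψ_zero_index, hi] using integral_ψ_mul_conj hm i 0
  · simp; omega

theorem integral_norm_dirichlet_M (hm : ∀ k, 2 ≤ m k) (j : ℕ) :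
    ∫ x, ‖dirichlet m (M m j) x‖ ∂μ m = 1 := by
  have h : ∀ x, ((‖dirichlet m (M m j) x‖ : ℝ) : ℂ) = dirichlet m (M m j) x := fun x => by
    rw [dirichlet_M hm]; split_ifs <;> simp
  rw [← Complex.ofReal_inj, ← integral_complex_ofReal]
  simp_rw [h]
  rw [integral_dirichlet hm (M_pos hm j), Complex.ofReal_one]

end
-- $L^1$ bounds for Fejér kernels.
section
variable {m : ℕ → ℕ}

theorem fejer_mul_add (hm : ∀ k, 2 ≤ m k) {r j s : ℕ} (hr : r ≤ M m j) (hs : s < m j)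
    (x : G m) :
    fejer m (s * M m j + r) x = fejer m (s * M m j) x +
      (r * (∑ t ∈ Finset.range s, rademacher m j x ^ t) * dirichlet m (M m j) x +
        rademacher m j x ^ s * fejer m r x) := by
  rw [fejer, Finset.sum_range_add, ← fejer]
  congr 1
  rw [Finset.sum_congr rfl fun k hk =>
    dirichlet_mul_add hm ((Finset.mem_range.1 hk).le.trans hr) hs x]
  simp [Finset.sum_add_distrib, ← Finset.mul_sum, fejer, mul_assoc]

theorem fejer_mul (hm : ∀ k, 2 ≤ m k) {j s : ℕ} (hs : s ≤ m j) (x : G m) :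
    fejer m (s * M m j) x =
      M m j * (∑ u ∈ Finset.range s, ∑ t ∈ Finset.range u, rademacher m j x ^ t) *
          dirichlet m (M m j) x +
        (∑ u ∈ Finset.range s, rademacher m j x ^ u) * fejer m (M m j) x := by
  induction s with
  | zero => simp [fejer]
  | succ s ih =>
    rw [Nat.succ_mul, fejer_mul_add hm le_rfl hs, ih (by omega), Finset.sum_range_succ,
      Finset.sum_range_succ _ s]
    ring

end

section
variable {m : ℕ → ℕ} [∀ k, NeZero (m k)]

theorem norm_sum_rademacher_pow_le (j s : ℕ) (x : G m) :
    ‖∑ t ∈ Finset.range s, rademacher m j x ^ t‖ ≤ s := by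
  refine (norm_sum_le _ _).trans ?_
  simp [norm_rademacher]

theorem norm_sum_sum_rademacher_pow_le (j s : ℕ) (x : G m) :
    ‖∑ u ∈ Finset.range s, ∑ t ∈ Finset.range u, rademacher m j x ^ t‖ ≤ (s : ℝ) ^ 2 := by
  refine (norm_sum_le _ _).trans ?_
  calc _ ≤ ∑ u ∈ Finset.range s, (s : ℝ) := Finset.sum_le_sum fun u hu =>
        (norm_sum_rademacher_pow_le j u x).trans (by exact_mod_cast (Finset.mem_range.1 hu).le)
    _ = _ := by simp [sq]

/-- A function invariant under translations of the `j`-th coordinate is independent of that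
coordinate. -/
theorem integral_ite_of_invariant (j : ℕ) {φ : G m → ℝ} (hφ : Integrable φ (μ m))
    (hinv : ∀ (a : ZMod (m j)) x, φ (Pi.single j a + x) = φ x) :
    ∫ x, (if x j = 0 then (m j : ℝ) else 0) * φ x ∂μ m = ∫ x, φ x ∂μ m := by
  have hms : ∀ a : ZMod (m j), MeasurableSet {x : G m | x j = a} := fun a =>
    measurableSet_eq_fun (measurable_pi_apply j) measurable_const
  have h1 : ∀ a : ZMod (m j), ∫ x, {x : G m | x j = a}.indicator φ x ∂μ m =
      ∫ x, {x : G m | x j = 0}.indicator φ x ∂μ m := fun a => by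
    rw [← integral_add_left_eq_self _ (Pi.single j a : G m)]
    congr 1
    funext x
    simp only [Set.indicator, Set.mem_ofPred_eq, Pi.add_apply, Pi.single_eq_same, hinv]
    congr 1
    simp
  have h2 : ∀ x, φ x = ∑ a : ZMod (m j), {x : G m | x j = a}.indicator φ x := fun x => by
    rw [Finset.sum_eq_single (x j)]
    · simp
    · intro a _ ha
      exact Set.indicator_of_notMem (fun h => ha h.symm) φ
    · simp
  conv_rhs => rw [integral_congr_ae (Eventually.of_forall h2)]
  rw [integral_finsetSum _ fun a _ => hφ.indicator (hms a), Finset.sum_congr rfl fun a _ => h1 a]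
  rw [Finset.sum_const, Finset.card_univ, ZMod.card, nsmul_eq_mul, ← integral_const_mul]
  congr 1
  funext x
  by_cases h : x j = 0 <;> simp [h]

/-- In the recursion the old kernel is multiplied by $m_j1_{x_j=0}$, which has mean one and is
independent of it, so its norm is carried over without growth. The new term costs at most
$m_j^2M_j$. -/
theorem integral_norm_fejer_M_le (hm : ∀ k, 2 ≤ m k) {b : ℕ} (hb : ∀ k, m k ≤ b) (j : ℕ) :
    ∫ x, ‖fejer m (M m j) x‖ ∂μ m ≤ 2 * b * M m j := by
  induction j with
  | zero => simp [M, fejer, dirichlet]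
  | succ j ih =>
    have hD := (integrable_dirichlet m (M m j)).norm
    have hF := (integrable_fejer m (M m j)).norm
    have hpt : ∀ x, ‖fejer m (M m (j + 1)) x‖ ≤ M m j * (m j : ℝ) ^ 2 * ‖dirichlet m (M m j) x‖ +
        (if x j = 0 then (m j : ℝ) else 0) * ‖fejer m (M m j) x‖ := fun x => by
      rw [M, fejer_mul hm le_rfl, sum_rademacher_pow]
      refine (norm_add_le _ _).trans (add_le_add ?_ ?_)
      · rw [norm_mul, norm_mul, Complex.norm_natCast]
        gcongr
        exact norm_sum_sum_rademacher_pow_le _ _ _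
      · rw [norm_mul]
        split_ifs <;> simp
    have hi : Integrable (fun x : G m => (if x j = 0 then (m j : ℝ) else 0) *
        ‖fejer m (M m j) x‖) (μ m) := by
      refine (hF.const_mul (m j : ℝ)).mono' ?_ (Eventually.of_forall fun x => ?_)
      · refine (Measurable.mul (Measurable.ite ?_ measurable_const measurable_const)
          (measurable_fejer m _).norm).aestronglyMeasurable
        exact measurableSet_eq_fun (measurable_pi_apply j) measurable_const
      · split_ifs
        · simp
        · simp; positivity
    have hle := integral_mono (integrable_fejer m (M m (j + 1))).norm
      ((hD.const_mul _).add hi) hpt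
    simp only [Pi.add_apply] at hle
    rw [integral_add (hD.const_mul _) hi, integral_const_mul, integral_norm_dirichlet_M hm,
      integral_ite_of_invariant j hF fun a x => by rw [fejer_add_single hm]] at hle
    have h2 : (2 : ℝ) ≤ m j := by exact_mod_cast hm j
    have h3 : (m j : ℝ) ≤ b := by exact_mod_cast hb j
    have hM : (0 : ℝ) ≤ M m j := by positivity
    have : (M m (j + 1) : ℝ) = m j * M m j := by simp [M]
    rw [this]
    -- The induction closes because $m_j^2\le bm_j$ and $2b\le bm_j$.
    nlinarith [mul_le_mul_of_nonneg_left h3 (mul_nonneg hM (by linarith : (0 : ℝ) ≤ m j)),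
      mul_nonneg (mul_nonneg hM (by linarith : (0 : ℝ) ≤ b)) (by linarith : (0 : ℝ) ≤ m j - 2)]

/-- On a bounded Vilenkin group the Fejér kernels are bounded in `L¹`. -/
theorem integral_norm_fejer_le (hm : ∀ k, 2 ≤ m k) {b : ℕ} (hb : ∀ k, m k ≤ b) {j l : ℕ}
    (hl : l ≤ M m j) : ∫ x, ‖fejer m l x‖ ∂μ m ≤ 4 * b ^ 2 * M m j := by
  have hb2 : (2 : ℝ) ≤ b := by exact_mod_cast (hm 0).trans (hb 0)
  induction j generalizing l with
  | zero =>
    simp only [M] at hl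
    interval_cases l
    · simp [fejer, M]
    · simp [fejer, M, dirichlet]
  | succ j ih =>
    have h2 : (2 : ℝ) ≤ m j := by exact_mod_cast hm j
    have h3 : (m j : ℝ) ≤ b := by exact_mod_cast hb j
    have hM : (0 : ℝ) ≤ M m j := by positivity
    have hMs : (M m (j + 1) : ℝ) = m j * M m j := by simp [M]
    rcases hl.eq_or_lt with rfl | hlt
    · refine (integral_norm_fejer_M_le hm hb (j + 1)).trans ?_
      nlinarith [mul_nonneg (Nat.cast_nonneg (α := ℝ) (M m (j + 1)))
        (by nlinarith : (0 : ℝ) ≤ 4 * b ^ 2 - 2 * b)]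
    have h0 := M_pos hm j
    obtain ⟨s, r, rfl, hs, hr⟩ : ∃ s r, l = s * M m j + r ∧ s < m j ∧ r < M m j :=
      ⟨l / M m j, l % M m j, (Nat.div_add_mod' l _).symm,
        Nat.div_lt_of_lt_mul (by simpa [M, mul_comm] using hlt), Nat.mod_lt _ h0⟩
    have hD := (integrable_dirichlet m (M m j)).norm
    have hF := (integrable_fejer m (M m j)).norm
    have hR := (integrable_fejer m r).norm
    have hDF : Integrable (fun x => (M m j * (s : ℝ) ^ 2 + r * s) * ‖dirichlet m (M m j) x‖ +
        s * ‖fejer m (M m j) x‖) (μ m) := (hD.const_mul _).add (hF.const_mul _)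
    have hpt : ∀ x, ‖fejer m (s * M m j + r) x‖ ≤
        ((M m j * (s : ℝ) ^ 2 + r * s) * ‖dirichlet m (M m j) x‖ + s * ‖fejer m (M m j) x‖) +
          ‖fejer m r x‖ := fun x => by
      rw [fejer_mul_add hm hr.le hs, fejer_mul hm hs.le]
      set d := dirichlet m (M m j) x
      have e1 : ‖(M m j * (∑ u ∈ Finset.range s, ∑ t ∈ Finset.range u, rademacher m j x ^ t) * d : ℂ)‖
          ≤ M m j * (s : ℝ) ^ 2 * ‖d‖ := by
        rw [norm_mul, norm_mul, Complex.norm_natCast]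
        gcongr
        exact norm_sum_sum_rademacher_pow_le _ _ _
      have e2 : ‖(∑ u ∈ Finset.range s, rademacher m j x ^ u) * fejer m (M m j) x‖ ≤
          s * ‖fejer m (M m j) x‖ := by
        rw [norm_mul]
        gcongr
        exact norm_sum_rademacher_pow_le _ _ _
      have e3 : ‖(r * (∑ t ∈ Finset.range s, rademacher m j x ^ t) * d : ℂ)‖ ≤ r * s * ‖d‖ := by
        rw [norm_mul, norm_mul, Complex.norm_natCast]
        gcongr
        exact norm_sum_rademacher_pow_le _ _ _
      have e4 : ‖rademacher m j x ^ s * fejer m r x‖ = ‖fejer m r x‖ := by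
        rw [norm_mul, norm_pow, norm_rademacher, one_pow, one_mul]
      refine (norm_add_le _ _).trans ((add_le_add (norm_add_le _ _) (norm_add_le _ _)).trans ?_)
      rw [e4]
      linarith
    have hle := integral_mono (integrable_fejer m (s * M m j + r)).norm
      (hDF.add hR) hpt
    simp only [Pi.add_apply] at hle
    rw [integral_add hDF hR,
      integral_add (hD.const_mul _) (hF.const_mul _), integral_const_mul, integral_const_mul,
      integral_norm_dirichlet_M hm] at hle
    have h4 := integral_norm_fejer_M_le hm hb j
    have h5 := ih hr.le
    have hs' : (s : ℝ) ≤ b := (by exact_mod_cast hs.le : (s : ℝ) ≤ m j).trans h3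
    have hr' : (r : ℝ) ≤ M m j := by exact_mod_cast hr.le
    have h6 : (M m j * (s : ℝ) ^ 2 + r * s) ≤ M m j * (b : ℝ) ^ 2 + M m j * b := by gcongr
    have h7 : s * ∫ x, ‖fejer m (M m j) x‖ ∂μ m ≤ b * (2 * b * M m j) := by
      gcongr
    have h8 : (M m j : ℝ) * b ≤ M m j * b ^ 2 := by
      gcongr
      nlinarith
    have h9 : 4 * (b : ℝ) ^ 2 * M m j * 2 ≤ 4 * (b : ℝ) ^ 2 * M m j * m j := by gcongr
    rw [hMs]
    linarith

end
-- Small translations, partial sums and block estimates.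
section
variable {m : ℕ → ℕ}

/-- The largest digits telescope: $(m_k-1)/M_{k+1}=1/M_k-1/M_{k+1}$. -/
theorem size_le (hm : ∀ k, 2 ≤ m k) {j : ℕ} {t : G m} [∀ k, NeZero (m k)]
    (ht : ∀ k < j, t k = 0) : size m t ≤ (M m j : ℝ)⁻¹ := by
  have hpos : ∀ k, (0 : ℝ) < M m k := fun k => by exact_mod_cast M_pos hm k
  have h0 : ∀ k, 0 ≤ ((t k).val : ℝ) / (M m (k + 1) : ℝ) := fun k => by positivity
  have key : ∀ n, ∑ k ∈ Finset.range (j + n), ((t k).val : ℝ) / (M m (k + 1) : ℝ) ≤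
      (M m j : ℝ)⁻¹ - (M m (j + n) : ℝ)⁻¹ := fun n => by
    induction n with
    | zero =>
      rw [Finset.sum_eq_zero]
      · simp
      · intro k hk
        simp [ht k (by simpa using hk)]
    | succ n ih =>
      rw [← add_assoc, Finset.sum_range_succ]
      have h1 : ((t (j + n)).val : ℝ) ≤ m (j + n) - 1 := by
        have : (t (j + n)).val + 1 ≤ m (j + n) := ZMod.val_lt _
        have : ((t (j + n)).val : ℝ) + 1 ≤ m (j + n) := by exact_mod_cast this
        linarith
      have h2 : (0 : ℝ) < m (j + n) := by
        have := hm (j + n)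
        exact_mod_cast (by omega : 0 < m (j + n))
      have h3 : ((t (j + n)).val : ℝ) / (M m (j + n + 1) : ℝ) ≤
          (M m (j + n) : ℝ)⁻¹ - (M m (j + n + 1) : ℝ)⁻¹ := by
        have h4 : (M m (j + n + 1) : ℝ) = m (j + n) * M m (j + n) := by simp [M]
        have h5 := hpos (j + n)
        calc _ ≤ ((m (j + n) : ℝ) - 1) / (M m (j + n + 1) : ℝ) := by gcongr
          _ = _ := by rw [h4]; field_simp
      linarith
  refine Real.tsum_le_of_sum_range_le h0 fun n => ?_
  calc _ ≤ ∑ k ∈ Finset.range (j + n), ((t k).val : ℝ) / (M m (k + 1) : ℝ) :=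
        Finset.sum_le_sum_of_subset_of_nonneg (Finset.range_mono (by omega)) fun k _ _ => h0 k
    _ ≤ (M m j : ℝ)⁻¹ := (key n).trans (by linarith [inv_pos.2 (hpos (j + n))])

end

section
variable {m : ℕ → ℕ} [∀ k, NeZero (m k)] {p : ℝ≥0∞} {f : G m → ℂ}

theorem integrable_comp_sub_mul_ψ (hf : Integrable f (μ m)) (x : G m) (i : ℕ) :
    Integrable (fun t => f (x - t) * ψ m i t) (μ m) :=
  (hf.comp_sub_left x).mul_bdd (measurable_ψ m i).aestronglyMeasurable
    (Eventually.of_forall fun t => (norm_ψ m i t).le)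

theorem coeff_mul_ψ (f : G m → ℂ) (i : ℕ) (x : G m) :
    coeff m f i * ψ m i x = ∫ t, f (x - t) * ψ m i t ∂μ m := by
  rw [coeff, ← integral_sub_left_eq_self _ (μ m) x, ← integral_mul_const]
  congr 1
  funext t
  rw [mul_assoc, mul_comm _ (ψ m i x), ψ_mul_conj_sub]

theorem integrable_comp_sub_mul_dirichlet (hf : Integrable f (μ m)) (x : G m) (k : ℕ) :
    Integrable (fun t => f (x - t) * dirichlet m k t) (μ m) := by
  simp_rw [dirichlet, Finset.mul_sum]
  exact integrable_finsetSum _ fun i _ => integrable_comp_sub_mul_ψ hf x i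

theorem S_eq_integral (hf : Integrable f (μ m)) (k : ℕ) (x : G m) :
    S m f k x = ∫ t, f (x - t) * dirichlet m k t ∂μ m := by
  simp_rw [S, coeff_mul_ψ, dirichlet, Finset.mul_sum]
  rw [integral_finsetSum _ fun i _ => integrable_comp_sub_mul_ψ hf x i]

theorem sum_Ico_S_eq_integral (hf : Integrable f (μ m)) {a l : ℕ} (hal : a ≤ l) (x : G m) :
    ∑ k ∈ Finset.Ico a l, S m f k x =
      ∫ t, f (x - t) * (fejer m l t - fejer m a t) ∂μ m := by
  simp_rw [S_eq_integral hf]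
  rw [← integral_finsetSum _ fun k _ => integrable_comp_sub_mul_dirichlet hf x k]
  simp_rw [← Finset.mul_sum, Finset.sum_Ico_eq_sub _ hal, fejer]

theorem measurable_S (f : G m → ℂ) (k : ℕ) : Measurable (S m f k) :=
  Finset.measurable_sum _ fun i _ => (measurable_ψ m i).const_mul _

theorem memLp_S (f : G m → ℂ) (k : ℕ) (p : ℝ≥0∞) : MemLp (S m f k) p (μ m) := by
  refine MemLp.of_bound (measurable_S f k).aestronglyMeasurable
    (∑ i ∈ Finset.range k, ‖coeff m f i‖) (Eventually.of_forall fun x => ?_)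
  refine (norm_sum_le _ _).trans (Finset.sum_le_sum fun i _ => ?_)
  rw [norm_mul, norm_ψ, mul_one]

theorem coeff_S (hm : ∀ k, 2 ≤ m k) (f : G m → ℂ) (n i : ℕ) :
    coeff m (S m f n) i = if i < n then coeff m f i else 0 := by
  have hint : ∀ k, Integrable (fun x => coeff m f k * (ψ m k x * (starRingEnd ℂ) (ψ m i x)))
      (μ m) := fun k => by
    refine ((integrable_ψ m k).mul_bdd (c := 1) ?_ (Eventually.of_forall fun x => ?_)).const_mul _
    · exact (Complex.continuous_conj.measurable.comp (measurable_ψ m i)).aestronglyMeasurable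
    · simp [norm_ψ]
  rw [coeff]
  simp_rw [S, Finset.sum_mul, mul_assoc]
  rw [integral_finsetSum _ fun k _ => hint k]
  simp_rw [integral_const_mul, integral_ψ_mul_conj hm]
  simp

theorem S_S (hm : ∀ k, 2 ≤ m k) (f : G m → ℂ) {n k : ℕ} (h : n ≤ k) (x : G m) :
    S m (S m f n) k x = S m f n x := by
  simp_rw [S]
  refine (Finset.sum_subset (Finset.range_mono h) fun i _ hi => ?_).symm.trans
    (Finset.sum_congr rfl fun i hi => ?_)
  · change coeff m (S m f n) i * _ = 0
    rw [coeff_S hm, if_neg (by simpa using hi), zero_mul]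
  · rw [coeff_S hm, if_pos (Finset.mem_range.1 hi)]

theorem S_sub {g : G m → ℂ} (hf : Integrable f (μ m)) (hg : Integrable g (μ m)) (k : ℕ)
    (x : G m) : S m (f - g) k x = S m f k x - S m g k x := by
  rw [S_eq_integral (hf.sub hg), S_eq_integral hf, S_eq_integral hg,
    ← integral_sub (integrable_comp_sub_mul_dirichlet hf x k)
      (integrable_comp_sub_mul_dirichlet hg x k)]
  simp [sub_mul]

theorem aestronglyMeasurable_comp_sub (hf : AEStronglyMeasurable f (μ m)) :
    AEStronglyMeasurable (fun z : G m × G m => f (z.1 - z.2)) ((μ m).prod (μ m)) :=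
  hf.comp_quasiMeasurePreserving (quasiMeasurePreserving_sub (μ m) (μ m))

theorem eLpNorm_comp_sub (hf : AEStronglyMeasurable f (μ m)) (t : G m) :
    eLpNorm (fun x => f (x - t)) p (μ m) = eLpNorm f p (μ m) :=
  eLpNorm_comp_measurePreserving hf (measurePreserving_sub_right (μ m) t)

/-- $D_{M_j}$ is non-negative with integral one, so $S_{M_j}f$ averages translates of $f$ by $t$
vanishing in the first $j$ coordinates. -/
theorem eLpNorm_sub_S_le (hm : ∀ k, 2 ≤ m k) (hp : 1 ≤ p) (hp' : p ≠ ∞) (hf : MemLp f p (μ m))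
    {j : ℕ} {B : ℝ≥0∞}
    (hB : ∀ t : G m, (∀ k < j, t k = 0) → eLpNorm (fun x => f (x - t) - f x) p (μ m) ≤ B) :
    eLpNorm (f - S m f (M m j)) p (μ m) ≤ B := by
  have hfi : Integrable f (μ m) := hf.integrable hp
  have heq : S m f (M m j) - f =
      fun x => ∫ t, (f (x - t) - f x) * dirichlet m (M m j) t ∂μ m := by
    funext x
    simp_rw [sub_mul]
    rw [integral_sub (integrable_comp_sub_mul_dirichlet hfi x _)
      ((integrable_dirichlet m _).const_mul _), integral_const_mul,
      integral_dirichlet hm (M_pos hm j), mul_one, Pi.sub_apply, S_eq_integral hfi]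
  rw [eLpNorm_sub_comm, heq]
  refine (eLpNorm_integral_mul_le hp hp' (h := fun z : G m × G m => f (z.1 - z.2) - f z.1) ?_
    (measurable_dirichlet m _) (integrable_dirichlet m _) (B := B) fun t ht => hB t ?_).trans_eq ?_
  · exact (aestronglyMeasurable_comp_sub hf.1).sub hf.1.comp_fst
  · by_contra h
    exact ht (by rw [dirichlet_M hm, if_neg h])
  · rw [← ofReal_integral_norm_eq_lintegral_enorm (integrable_dirichlet m _),
      integral_norm_dirichlet_M hm, ENNReal.ofReal_one, mul_one]

/-- The sums of `S_k f - f` over parts of the blocks `[M_j, M_{j+1})`. -/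
theorem eLpNorm_sum_S_sub_le (hm : ∀ k, 2 ≤ m k) {b : ℕ} (hb : ∀ k, m k ≤ b) (hp : 1 ≤ p)
    (hp' : p ≠ ∞) (hf : MemLp f p (μ m)) {j l : ℕ} (hjl : M m j ≤ l) (hl : l ≤ M m (j + 1))
    {B : ℝ} (hB0 : 0 ≤ B)
    (hB : ∀ t : G m, (∀ k < j, t k = 0) →
      eLpNorm (fun x => f (x - t) - f x) p (μ m) ≤ ENNReal.ofReal B) :
    eLpNorm (∑ k ∈ Finset.Ico (M m j) l, (S m f k - f)) p (μ m) ≤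
      ENNReal.ofReal ((8 * b ^ 3 + b) * M m j * B) := by
  set g := f - S m f (M m j) with hg
  have hfi : Integrable f (μ m) := hf.integrable hp
  have hSi : Integrable (S m f (M m j)) (μ m) := (memLp_S f _ 1).integrable le_rfl
  have hgL : MemLp g p (μ m) := hf.sub (memLp_S f _ p)
  have hgi : Integrable g (μ m) := hgL.integrable hp
  have hgB : eLpNorm g p (μ m) ≤ ENNReal.ofReal B := eLpNorm_sub_S_le hm hp hp' hf hB
  set K : G m → ℂ := fun t => fejer m l t - fejer m (M m j) t with hK
  have hKm : Measurable K := (measurable_fejer m l).sub (measurable_fejer m _)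
  have hKi : Integrable K (μ m) := (integrable_fejer m l).sub (integrable_fejer m _)
  -- For $k\ge M_j$, $S_k$ fixes $S_{M_j}f$, so $f$ may be replaced by the small function $g$.
  have heq : ∑ k ∈ Finset.Ico (M m j) l, (S m f k - f) =
      (fun x => ∫ t, g (x - t) * K t ∂μ m) - ((l - M m j : ℕ) : ℂ) • g := by
    funext x
    rw [Pi.sub_apply, ← sum_Ico_S_eq_integral hgi hjl, Finset.sum_apply, Pi.smul_apply,
      smul_eq_mul]
    have : ((l - M m j : ℕ) : ℂ) * g x = ∑ k ∈ Finset.Ico (M m j) l, g x := by simp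
    rw [this, ← Finset.sum_sub_distrib]
    refine Finset.sum_congr rfl fun k hk => ?_
    rw [hg, S_sub hfi hSi, S_S hm f (Finset.mem_Ico.1 hk).1]
    simp
  have hb0 : (0 : ℝ) ≤ b := by positivity
  have hM0 : (0 : ℝ) ≤ M m j := by positivity
  have hMs : (M m (j + 1) : ℝ) ≤ b * M m j := by
    have : (m j : ℝ) ≤ b := by exact_mod_cast hb j
    simp only [M, Nat.cast_mul]
    gcongr
  -- Two kernels, each at most $4b^2M_{j+1}\le4b^3M_j$.
  have hKn : ∫ t, ‖K t‖ ∂μ m ≤ 8 * b ^ 3 * M m j := by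
    have h1 := integral_mono hKi.norm
      ((integrable_fejer m l).norm.add (integrable_fejer m (M m j)).norm) fun t => norm_sub_le _ _
    simp only [Pi.add_apply] at h1
    rw [integral_add (integrable_fejer m l).norm (integrable_fejer m (M m j)).norm] at h1
    have h2 := integral_norm_fejer_le hm hb hl
    have h3 := integral_norm_fejer_le hm hb (M_mono hm (Nat.le_succ j))
    calc _ ≤ 8 * (b : ℝ) ^ 2 * M m (j + 1) := by simp only [Nat.succ_eq_add_one] at h3; linarith
      _ ≤ 8 * (b : ℝ) ^ 2 * (b * M m j) := by gcongr
      _ = _ := by ring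
  have hconv : eLpNorm (fun x => ∫ t, g (x - t) * K t ∂μ m) p (μ m) ≤
      ENNReal.ofReal (B * (8 * b ^ 3 * M m j)) := by
    refine (eLpNorm_integral_mul_le hp hp' (h := fun z : G m × G m => g (z.1 - z.2))
      (aestronglyMeasurable_comp_sub hgL.1) hKm hKi
      fun t _ => (eLpNorm_comp_sub hgL.1 t).le.trans hgB).trans ?_
    rw [← ofReal_integral_norm_eq_lintegral_enorm hKi, ← ENNReal.ofReal_mul hB0]
    gcongr
  have hconst : eLpNorm (((l - M m j : ℕ) : ℂ) • g) p (μ m) ≤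
      ENNReal.ofReal (b * M m j * B) := by
    rw [eLpNorm_const_smul, ENNReal.ofReal_mul (by positivity)]
    gcongr
    rw [← ofReal_norm, Complex.norm_natCast]
    gcongr
    refine le_trans ?_ hMs
    exact_mod_cast (Nat.sub_le _ _).trans hl
  have hcm : AEStronglyMeasurable (fun x => ∫ t, g (x - t) * K t ∂μ m) (μ m) := by
    refine AEStronglyMeasurable.integral_prod_right'
      (f := fun z : G m × G m => g (z.1 - z.2) * K z.2) ?_
    exact (aestronglyMeasurable_comp_sub hgL.1).mul (hKm.comp measurable_snd).aestronglyMeasurable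
  rw [heq]
  refine (eLpNorm_sub_le hcm (hgL.1.const_smul _) hp).trans ((add_le_add hconv hconst).trans_eq ?_)
  rw [← ENNReal.ofReal_add (by positivity) (by positivity)]
  congr 1
  ring

/-- The Lipschitz condition speaks only of small $\delta$. For the remaining $j$, with
$M_j\le2/\varepsilon$, the trivial bound $2\|f\|_p$ suffices after enlarging the constant. -/
theorem Lip.exists_bound (hm : ∀ k, 2 ≤ m k) (hp : 1 ≤ p) {α : ℝ} (hα : 0 < α)
    (hf : Lip m α p f) :
    ∃ C : ℝ, 0 ≤ C ∧ ∀ (j : ℕ) (t : G m), (∀ k < j, t k = 0) →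
      eLpNorm (fun x => f (x - t) - f x) p (μ m) ≤ ENNReal.ofReal (C * (M m j : ℝ) ^ (-α)) := by
  obtain ⟨hfL, C, hC⟩ := hf
  obtain ⟨ε, hε, hεC⟩ := mem_nhdsGT_iff_exists_Ioo_subset.1 hC
  have hε : 0 < ε := hε
  set A := (eLpNorm f p (μ m)).toReal with hA
  refine ⟨|C| * 2 ^ α + 2 * A * (2 / ε) ^ α, by positivity, fun j t ht => ?_⟩
  have hM : (0 : ℝ) < M m j := by exact_mod_cast M_pos hm j
  rcases lt_or_ge (2 / (M m j : ℝ)) ε with h | h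
  -- The modulus requires strict inequality while `size_le` gives only $|t|\le1/M_j$, hence
  -- $\delta=2/M_j$.
  · have hmem : eLpNorm (fun x => f (x - t) - f x) p (μ m) ≤ modulus m p (2 / (M m j : ℝ)) f := by
      refine le_iSup₂_of_le t ?_ le_rfl
      refine (size_le hm ht).trans_lt ?_
      rw [div_eq_mul_inv]
      linarith [inv_pos.2 hM]
    refine (hmem.trans (hεC ⟨by positivity, h⟩)).trans (ENNReal.ofReal_le_ofReal ?_)
    rw [Real.div_rpow zero_le_two hM.le, Real.rpow_neg hM.le, add_mul, div_eq_mul_inv, ← mul_assoc]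
    have h1 : C * 2 ^ α * ((M m j : ℝ) ^ α)⁻¹ ≤ |C| * 2 ^ α * ((M m j : ℝ) ^ α)⁻¹ := by
      gcongr
      exact le_abs_self C
    have h2 : 0 ≤ 2 * A * (2 / ε) ^ α * ((M m j : ℝ) ^ α)⁻¹ := by positivity
    linarith
  · have hsh : AEStronglyMeasurable (fun x => f (x - t)) (μ m) :=
      hfL.1.comp_quasiMeasurePreserving
        (measurePreserving_sub_right (μ m) t).quasiMeasurePreserving
    have h1 : eLpNorm (fun x => f (x - t) - f x) p (μ m) ≤ ENNReal.ofReal (2 * A) := by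
      refine (eLpNorm_sub_le hsh hfL.1 hp).trans_eq ?_
      rw [eLpNorm_comp_sub hfL.1, two_mul, ENNReal.ofReal_add (by positivity) (by positivity), hA,
        ENNReal.ofReal_toReal hfL.2.ne]
    refine h1.trans (ENNReal.ofReal_le_ofReal ?_)
    have h2 : (1 : ℝ) ≤ (2 / ε) ^ α * (M m j : ℝ) ^ (-α) := by
      rw [Real.rpow_neg hM.le, ← div_eq_mul_inv, ← Real.div_rpow (by positivity) hM.le]
      refine Real.one_le_rpow ?_ hα.le
      rw [le_div_iff₀ hM, one_mul, le_div_comm₀ hM hε]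
      exact h
    have h3 : 0 ≤ |C| * 2 ^ α * (M m j : ℝ) ^ (-α) := by positivity
    calc 2 * A ≤ 2 * A * ((2 / ε) ^ α * (M m j : ℝ) ^ (-α)) :=
          le_mul_of_one_le_right (by positivity) h2
      _ ≤ _ := by linarith

end
end Vilenkin

/-! ### Abel summation over blocks. -/

section Summation
variable {E : Type*} [SeminormedAddCommGroup E] [NormedSpace ℝ E] {q : ℕ → ℝ} {u : ℕ → E}

/-- Abel's inequality. -/
theorem norm_sum_Ico_smul_le_of_antitone (hq0 : ∀ k, 0 ≤ q k) (hq : Antitone q) {a b : ℕ}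
    (hab : a ≤ b) {B : ℝ} (hB : ∀ l, a ≤ l → l ≤ b → ‖∑ k ∈ Finset.Ico a l, u k‖ ≤ B) :
    ‖∑ k ∈ Finset.Ico a b, q k • u k‖ ≤ q a * B := by
  -- With the boundary term $q_l\sum u_k$ removed, each step adds at most $(q_l-q_{l+1})B$, and
  -- these increments telescope.
  have key : ∀ l, a ≤ l → l ≤ b →
      ‖∑ k ∈ Finset.Ico a l, q k • u k - q l • ∑ k ∈ Finset.Ico a l, u k‖ ≤ (q a - q l) * B := by
    intro l hal
    induction l, hal using Nat.le_induction with
    | base => simp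
    | succ l hal ih =>
      intro hlb
      have h1 := ih (by omega)
      have h2 := hB (l + 1) (by omega) hlb
      have h3 : ∑ k ∈ Finset.Ico a (l + 1), q k • u k -
          q (l + 1) • ∑ k ∈ Finset.Ico a (l + 1), u k =
          (∑ k ∈ Finset.Ico a l, q k • u k - q l • ∑ k ∈ Finset.Ico a l, u k) +
            (q l - q (l + 1)) • ∑ k ∈ Finset.Ico a (l + 1), u k := by
        rw [Finset.sum_Ico_succ_top hal, Finset.sum_Ico_succ_top hal]
        module
      have hd : 0 ≤ q l - q (l + 1) := sub_nonneg.2 (hq (Nat.le_succ l))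
      rw [h3]
      refine (norm_add_le _ _).trans ?_
      rw [norm_smul, Real.norm_of_nonneg hd]
      nlinarith [mul_le_mul_of_nonneg_left h2 hd]
  have h1 := key b hab le_rfl
  have h2 := mul_le_mul_of_nonneg_left (hB b hab le_rfl) (hq0 b)
  calc ‖∑ k ∈ Finset.Ico a b, q k • u k‖
      = ‖(∑ k ∈ Finset.Ico a b, q k • u k - q b • ∑ k ∈ Finset.Ico a b, u k) +
          q b • ∑ k ∈ Finset.Ico a b, u k‖ := by rw [sub_add_cancel]
    _ ≤ (q a - q b) * B + q b * B := by
        refine (norm_add_le _ _).trans (add_le_add h1 ?_)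
        rwa [norm_smul, Real.norm_of_nonneg (hq0 b)]
    _ = q a * B := by ring

theorem norm_sum_Ico_smul_le_sum_blocks (hq0 : ∀ k, 0 ≤ q k) (hq : Antitone q) {N : ℕ → ℕ}
    (hN : Monotone N) {B : ℕ → ℝ}
    (hB : ∀ j l, N j ≤ l → l ≤ N (j + 1) → ‖∑ k ∈ Finset.Ico (N j) l, u k‖ ≤ B j)
    {J n : ℕ} (h1 : N J ≤ n) (h2 : n ≤ N (J + 1)) :
    ‖∑ k ∈ Finset.Ico (N 0) n, q k • u k‖ ≤ ∑ j ∈ Finset.range (J + 1), q (N j) * B j := by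
  have hlast : ‖∑ k ∈ Finset.Ico (N J) n, q k • u k‖ ≤ q (N J) * B J :=
    norm_sum_Ico_smul_le_of_antitone hq0 hq h1 fun l hl hl' => hB J l hl (hl'.trans h2)
  induction J generalizing n with
  | zero => simpa using hlast
  | succ J ih =>
    rw [← Finset.sum_Ico_consecutive _ (hN (Nat.zero_le (J + 1))) h1, Finset.sum_range_succ]
    refine (norm_add_le _ _).trans (add_le_add (ih (hN (Nat.le_succ J)) le_rfl ?_) hlast)
    exact norm_sum_Ico_smul_le_of_antitone hq0 hq (hN (Nat.le_succ J)) fun l hl hl' => hB J l hl hl'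

end Summation

/-! ### Power sums along a sequence that at least doubles. -/

section Growth

theorem exists_le_and_lt_succ {N : ℕ → ℕ} (hN : ∀ k, k < N k) (hN0 : N 0 = 1) {n : ℕ}
    (hn : 1 ≤ n) : ∃ J, N J ≤ n ∧ n < N (J + 1) := by
  have h0 : N 0 ≤ n := by omega
  refine ⟨Nat.findGreatest (fun J => N J ≤ n) n, ?_, ?_⟩
  · exact Nat.findGreatest_spec (P := fun J => N J ≤ n) (Nat.zero_le n) h0
  · by_contra! h
    have h1 := Nat.le_findGreatest (P := fun J => N J ≤ n) ((hN _).le.trans h) h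
    omega

variable {N : ℕ → ℕ}

theorem two_pow_le_of_two_mul_le (hN0 : N 0 = 1) (hN : ∀ j, 2 * N j ≤ N (j + 1)) (j : ℕ) :
    2 ^ j ≤ N j := by
  induction j with
  | zero => simp [hN0]
  | succ j ih => rw [pow_succ]; linarith [hN j]

/-- The last term dominates. The constant $K$ is the fixed point of $K=2^{-\gamma}K+1$, which is
what the induction needs. -/
theorem sum_rpow_le_of_pos (hN0 : N 0 = 1) (hN : ∀ j, 2 * N j ≤ N (j + 1)) {γ : ℝ} (hγ : 0 < γ)
    (J : ℕ) :
    ∑ j ∈ Finset.range (J + 1), (N j : ℝ) ^ γ ≤ 2 ^ γ / (2 ^ γ - 1) * (N J : ℝ) ^ γ := by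
  have h1 : (1 : ℝ) < 2 ^ γ := Real.one_lt_rpow one_lt_two hγ
  have h2 : (0 : ℝ) < 2 ^ γ - 1 := by linarith
  induction J with
  | zero =>
    simp only [zero_add, Finset.sum_range_one, hN0, Nat.cast_one, Real.one_rpow, mul_one]
    rw [le_div_iff₀ h2]
    linarith
  | succ J ih =>
    rw [Finset.sum_range_succ]
    have h3 : (2 : ℝ) ^ γ * (N J : ℝ) ^ γ ≤ (N (J + 1) : ℝ) ^ γ := by
      rw [← Real.mul_rpow zero_le_two (Nat.cast_nonneg _)]
      exact Real.rpow_le_rpow (by positivity) (by exact_mod_cast hN J) hγ.le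
    calc _ ≤ 1 / (2 ^ γ - 1) * ((2 : ℝ) ^ γ * (N J : ℝ) ^ γ) + (N (J + 1) : ℝ) ^ γ := by
          refine add_le_add (ih.trans_eq ?_) le_rfl
          ring
      _ ≤ 1 / (2 ^ γ - 1) * (N (J + 1) : ℝ) ^ γ + (N (J + 1) : ℝ) ^ γ := by gcongr
      _ = _ := by field_simp; ring

theorem sum_rpow_le_of_neg (hN0 : N 0 = 1) (hN : ∀ j, 2 * N j ≤ N (j + 1)) {γ : ℝ} (hγ : γ < 0)
    (J : ℕ) : ∑ j ∈ Finset.range J, (N j : ℝ) ^ γ ≤ (1 - 2 ^ γ)⁻¹ := by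
  have h1 : (2 : ℝ) ^ γ < 1 := Real.rpow_lt_one_of_one_lt_of_neg one_lt_two hγ
  have h0 : (0 : ℝ) ≤ 2 ^ γ := by positivity
  refine (Finset.sum_le_sum fun j _ => ?_).trans
    (sum_le_hasSum (Finset.range J) (fun j _ => pow_nonneg h0 j) (hasSum_geometric_of_lt_one h0 h1))
  rw [← Real.rpow_natCast, ← Real.rpow_mul zero_le_two, mul_comm, Real.rpow_mul zero_le_two,
    Real.rpow_natCast]
  exact Real.rpow_le_rpow_of_nonpos (by positivity)
    (by exact_mod_cast two_pow_le_of_two_mul_le hN0 hN j) hγ.le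

theorem natCast_le_log_div_log_two (hN0 : N 0 = 1) (hN : ∀ j, 2 * N j ≤ N (j + 1)) {J n : ℕ}
    (h : N J ≤ n) : (J : ℝ) ≤ Real.log n / Real.log 2 := by
  rw [le_div_iff₀ (Real.log_pos one_lt_two), ← Real.log_pow]
  exact Real.log_le_log (by positivity)
    (by exact_mod_cast (two_pow_le_of_two_mul_le hN0 hN J).trans h)

end Growth

/-! ### Bounds for the weights and for $Q_n$. -/

section Weights
variable {q : ℕ → ℝ} {β : ℝ}

theorem Antitone.exists_rpow_bounds (hq_nonneg : ∀ k, 0 ≤ q k) (hq_anti : Antitone q)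
    (hβ : 0 < β) (hq : q =Θ[atTop] fun k : ℕ => (k : ℝ) ^ (-β)) :
    ∃ c C : ℝ, 0 < c ∧ 0 ≤ C ∧ ∀ k : ℕ, 1 ≤ k →
      c * (k : ℝ) ^ (-β) ≤ q k ∧ q k ≤ C * (k : ℝ) ^ (-β) := by
  obtain ⟨C₁, hC₁, h1⟩ := hq.1.exists_pos
  obtain ⟨c₁, hc₁, h2⟩ := hq.2.exists_pos
  obtain ⟨K, hK⟩ := eventually_atTop.1 (h1.bound.and h2.bound)
  have hpos : ∀ k : ℕ, 0 ≤ (k : ℝ) ^ (-β) := fun k => by positivity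
  have hle : ∀ k : ℕ, 1 ≤ k → (k : ℝ) ^ (-β) ≤ 1 := fun k hk =>
    Real.rpow_le_one_of_one_le_of_nonpos (by exact_mod_cast hk) (by linarith)
  have hK1 : (0 : ℝ) < ((K + 1 : ℕ) : ℝ) := by positivity
  have hU : ∀ k, K ≤ k → q k ≤ C₁ * (k : ℝ) ^ (-β) := fun k hk => by
    have := (hK k hk).1
    rwa [Real.norm_of_nonneg (hq_nonneg k), Real.norm_of_nonneg (hpos k)] at this
  have hL : ∀ k, K ≤ k → (k : ℝ) ^ (-β) / c₁ ≤ q k := fun k hk => by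
    have := (hK k hk).2
    rw [Real.norm_of_nonneg (hq_nonneg k), Real.norm_of_nonneg (hpos k)] at this
    rw [div_le_iff₀ hc₁, mul_comm]
    exact this
  -- Below $K$ monotonicity takes over: $q_k\ge q_{K+1}$ with $k^{-\beta}\le1$, and $q_k\le q_0\le
  -- q_0((K+1)/k)^\beta$. Using $K+1$ keeps the base positive when $K=0$.
  refine ⟨((K + 1 : ℕ) : ℝ) ^ (-β) / c₁, C₁ + q 0 * ((K + 1 : ℕ) : ℝ) ^ β, by positivity,
    add_nonneg hC₁.le (mul_nonneg (hq_nonneg 0) (by positivity)), fun k hk => ?_⟩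
  have hq0 := hq_nonneg 0
  rcases le_or_gt K k with h | h
  · constructor
    · refine le_trans ?_ (hL k h)
      rw [div_mul_eq_mul_div]
      gcongr
      exact mul_le_of_le_one_left (hpos k) (hle _ (by omega))
    · refine (hU k h).trans ?_
      gcongr
      exact le_add_of_nonneg_right (by positivity)
  · constructor
    · refine le_trans ?_ ((hL (K + 1) (by omega)).trans (hq_anti (by omega : k ≤ K + 1)))
      exact mul_le_of_le_one_right (by positivity) (hle k hk)
    · refine (hq_anti (Nat.zero_le k)).trans ?_
      have hk0 : (0 : ℝ) < k := by exact_mod_cast hk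
      have h3 : (1 : ℝ) ≤ ((K + 1 : ℕ) : ℝ) ^ β * (k : ℝ) ^ (-β) := by
        rw [Real.rpow_neg hk0.le, ← div_eq_mul_inv, ← Real.div_rpow hK1.le hk0.le]
        refine Real.one_le_rpow ?_ hβ.le
        rw [le_div_iff₀ hk0, one_mul]
        exact_mod_cast (by omega : k ≤ K + 1)
      have h4 := mul_le_mul_of_nonneg_left h3 hq0
      have h5 := mul_nonneg hC₁.le (hpos k)
      linarith

theorem Antitone.mul_rpow_le_sum_range (hq_anti : Antitone q) {c : ℝ} {n : ℕ} (hn : 1 ≤ n)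
    (h : c * (n : ℝ) ^ (-β) ≤ q n) :
    c * (n : ℝ) ^ (1 - β) ≤ ∑ k ∈ Finset.range n, q k := by
  have hn0 : (0 : ℝ) < n := by exact_mod_cast hn
  calc c * (n : ℝ) ^ (1 - β) = n * (c * (n : ℝ) ^ (-β)) := by
        rw [sub_eq_add_neg, Real.rpow_add hn0, Real.rpow_one]; ring
    _ ≤ n * q n := by gcongr
    _ = ∑ k ∈ Finset.range n, q n := by simp
    _ ≤ _ := Finset.sum_le_sum fun k hk => hq_anti (Finset.mem_range.1 hk).le

theorem mul_log_le_sum_range (hq_nonneg : ∀ k, 0 ≤ q k) {c : ℝ} (hc : 0 ≤ c)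
    (h : ∀ k : ℕ, 1 ≤ k → c * (k : ℝ)⁻¹ ≤ q k) {n : ℕ} (hn : 1 ≤ n) :
    c * Real.log n ≤ ∑ k ∈ Finset.range n, q k := by
  obtain ⟨n, rfl⟩ := Nat.exists_eq_add_of_le' hn
  calc c * Real.log (n + 1 : ℕ) ≤ c * (harmonic n : ℝ) := by
        gcongr
        exact log_add_one_le_harmonic n
    _ = ∑ k ∈ Finset.range n, c * ((k + 1 : ℕ) : ℝ)⁻¹ := by
        simp [harmonic, Finset.mul_sum]
    _ ≤ ∑ k ∈ Finset.range n, q (k + 1) := Finset.sum_le_sum fun k _ => h _ (by omega)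
    _ ≤ _ := by
        rw [Finset.sum_range_succ']
        linarith [hq_nonneg 0]

end Weights

/-- Abel's inequality is stated in a normed space; this moves sums of functions into `Lp`, where it
applies. -/
theorem MeasureTheory.enorm_sum_smul_toLp {X ι : Type*} [MeasurableSpace X] {μ : Measure X}
    {p : ℝ≥0∞} [Countable ι] {v : ι → X → ℂ} (hv : ∀ k, MemLp (v k) p μ) (c : ι → ℝ)
    (s : Finset ι) :
    ‖∑ k ∈ s, c k • (hv k).toLp (v k)‖ₑ = eLpNorm (∑ k ∈ s, c k • v k) p μ := by
  rw [Lp.enorm_def]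
  refine eLpNorm_congr_ae ((Lp.coeFn_finsetSum _ _).trans ?_)
  have h1 : ∀ᵐ x ∂μ, ∀ k, (c k • (hv k).toLp (v k) : Lp ℂ p μ) x = c k • v k x := by
    refine ae_all_iff.2 fun k => ?_
    filter_upwards [Lp.coeFn_smul (c k) ((hv k).toLp (v k)), (hv k).coeFn_toLp] with x h2 h3
    rw [h2, Pi.smul_apply, h3]
  filter_upwards [h1] with x hx
  simp [hx]

/-! ### Assembling the weighted sum and the four rates. -/

namespace Vilenkin

section
variable {m : ℕ → ℕ} [∀ k, NeZero (m k)] {p : ℝ≥0∞} {f : G m → ℂ} {q : ℕ → ℝ}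

theorem T_sub_eq {n : ℕ} (hQ : ∑ k ∈ Finset.range n, q k ≠ 0) :
    (fun x => T m q f n x - f x) =
      (∑ k ∈ Finset.range n, q k)⁻¹ • ∑ k ∈ Finset.range n, q k • (S m f k - f) := by
  funext x
  have hQ' : ((∑ k ∈ Finset.range n, q k : ℝ) : ℂ) ≠ 0 := by exact_mod_cast hQ
  simp only [T, Pi.smul_apply, Finset.sum_apply, Pi.sub_apply, Complex.real_smul, mul_sub,
    Finset.sum_sub_distrib, ← Finset.sum_mul, Complex.ofReal_inv]
  rw [← Complex.ofReal_sum]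
  field_simp

/-- The weighted sums of `S_k f - f` for `f` in a Lipschitz class. -/
theorem Lip.exists_eLpNorm_sum_le (hm : ∀ k, 2 ≤ m k) (hbdd : BddAbove (Set.range m))
    (hq_nonneg : ∀ k, 0 ≤ q k) (hq_anti : Antitone q) {β C : ℝ} (hC : 0 ≤ C)
    (hqC : ∀ k : ℕ, 1 ≤ k → q k ≤ C * (k : ℝ) ^ (-β)) {α : ℝ} (hα : 0 < α)
    (hp : 1 ≤ p) (hp' : p ≠ ∞) (hf : Lip m α p f) :
    ∃ A : ℝ, 0 ≤ A ∧ ∀ n J : ℕ, M m J ≤ n → n ≤ M m (J + 1) →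
      eLpNorm (∑ k ∈ Finset.range n, q k • (S m f k - f)) p (μ m) ≤
        ENNReal.ofReal
          (A * (1 + ∑ j ∈ Finset.range (J + 1), (M m j : ℝ) ^ (1 - α - β))) := by
  obtain ⟨b, hb⟩ := hbdd
  replace hb : ∀ k, m k ≤ b := fun k => hb ⟨k, rfl⟩
  obtain ⟨D, hD, hLip⟩ := hf.exists_bound hm hp hα
  have : Fact (1 ≤ p) := ⟨hp⟩
  have hv : ∀ k, MemLp (S m f k - f) p (μ m) := fun k => (memLp_S f k p).sub hf.1
  set u : ℕ → Lp ℂ p (μ m) := fun k => (hv k).toLp (S m f k - f) with hu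
  set R : ℝ := 8 * b ^ 3 + b with hR
  have hR0 : 0 ≤ R := by positivity
  have hpos : ∀ k, (0 : ℝ) < M m k := fun k => by exact_mod_cast M_pos hm k
  have hblock : ∀ j l, M m j ≤ l → l ≤ M m (j + 1) →
      ‖∑ k ∈ Finset.Ico (M m j) l, u k‖ ≤ R * M m j * (D * (M m j : ℝ) ^ (-α)) := by
    intro j l h1 h2
    have h3 := enorm_sum_smul_toLp hv (fun _ => 1) (Finset.Ico (M m j) l)
    simp only [one_smul] at h3
    have h4 := eLpNorm_sum_S_sub_le hm hb hp hp' hf.1 h1 h2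
      (B := D * (M m j : ℝ) ^ (-α)) (by positivity) (hLip j)
    rw [← h3, ← ofReal_norm] at h4
    exact (ENNReal.ofReal_le_ofReal_iff (by positivity)).1 h4
  refine ⟨q 0 * ‖u 0‖ + C * R * D, add_nonneg (mul_nonneg (hq_nonneg 0) (norm_nonneg _))
    (by positivity), fun n J h1 h2 => ?_⟩
  have hn : 1 ≤ n := (M_pos hm J).trans_le h1
  rw [← enorm_sum_smul_toLp hv, ← ofReal_norm]
  refine ENNReal.ofReal_le_ofReal ?_
  have hsum := norm_sum_Ico_smul_le_sum_blocks hq_nonneg hq_anti (M_mono hm) hblock h1 h2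
  have hsum0 : 0 ≤ ∑ j ∈ Finset.range (J + 1), (M m j : ℝ) ^ (1 - α - β) :=
    Finset.sum_nonneg fun j _ => by positivity
  have hle : ∑ j ∈ Finset.range (J + 1), q (M m j) * (R * M m j * (D * (M m j : ℝ) ^ (-α))) ≤
      C * R * D * ∑ j ∈ Finset.range (J + 1), (M m j : ℝ) ^ (1 - α - β) := by
    rw [Finset.mul_sum]
    refine Finset.sum_le_sum fun j _ => ?_
    have h3 := hqC (M m j) (M_pos hm j)
    calc _ ≤ C * (M m j : ℝ) ^ (-β) * (R * M m j * (D * (M m j : ℝ) ^ (-α))) := by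
          have := (hpos j).le
          gcongr
      _ = _ := by
          rw [sub_eq_add_neg, sub_eq_add_neg, Real.rpow_add (hpos j), Real.rpow_add (hpos j),
            Real.rpow_one]
          ring
  have h0 : 0 ≤ q 0 * ‖u 0‖ := mul_nonneg (hq_nonneg 0) (norm_nonneg _)
  have hM0 : M m 0 = 1 := rfl
  -- The blocks start at $M_0=1$, so the term $k=0$ is split off; it accounts for the $1$ in the
  -- bound.
  rw [Finset.range_eq_Ico, Finset.sum_eq_sum_Ico_succ_bot hn]
  refine (norm_add_le _ _).trans ?_
  rw [norm_smul, Real.norm_of_nonneg (hq_nonneg 0)]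
  rw [hM0] at hsum
  have h5 := mul_nonneg h0 hsum0
  have h6 : 0 ≤ C * R * D := by positivity
  calc _ ≤ q 0 * ‖u 0‖ + C * R * D * ∑ j ∈ Finset.range (J + 1), (M m j : ℝ) ^ (1 - α - β) :=
        add_le_add le_rfl (hsum.trans hle)
    _ ≤ _ := by linarith

theorem eLpNorm_T_sub_le {n : ℕ} (hQ : 0 < ∑ k ∈ Finset.range n, q k) {A : ℝ}
    (hA : eLpNorm (∑ k ∈ Finset.range n, q k • (S m f k - f)) p (μ m) ≤ ENNReal.ofReal A) :
    eLpNorm (fun x => T m q f n x - f x) p (μ m) ≤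
      ENNReal.ofReal (A / ∑ k ∈ Finset.range n, q k) := by
  rw [T_sub_eq hQ.ne', eLpNorm_const_smul, div_eq_inv_mul, ENNReal.ofReal_mul (inv_pos.2 hQ).le,
    ← ofReal_norm, Real.norm_of_nonneg (inv_pos.2 hQ).le]
  gcongr

end
end Vilenkin

theorem corollary2 (m : ℕ → ℕ) [∀ k, NeZero (m k)] (hm : ∀ k, 2 ≤ m k)
    (hbdd : BddAbove (Set.range m))
    (q : ℕ → ℝ) (hq_nonneg : ∀ k, 0 ≤ q k) (hq_anti : Antitone q)
    (β : ℝ) (hβ_pos : 0 < β) (hβ_le : β ≤ 1)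
    (hq : q =Θ[atTop] fun k : ℕ => (k : ℝ) ^ (-β))
    (α : ℝ) (hα : 0 < α) (p : ℝ≥0∞) (hp_one : 1 ≤ p) (hp_top : p ≠ ∞)
    (f : Vilenkin.G m → ℂ) (hf : Vilenkin.Lip m α p f) :
    (α + β < 1 →
      ∃ C : ℝ, ∀ᶠ n : ℕ in atTop,
        eLpNorm (fun x => Vilenkin.T m q f n x - f x) p (Vilenkin.μ m) ≤
          ENNReal.ofReal (C * (n : ℝ) ^ (-α))) ∧
    (α + β = 1 →
      ∃ C : ℝ, ∀ᶠ n : ℕ in atTop,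
        eLpNorm (fun x => Vilenkin.T m q f n x - f x) p (Vilenkin.μ m) ≤
          ENNReal.ofReal (C * ((n : ℝ) ^ (-(1 - β)) * Real.log n + (n : ℝ) ^ (-α)))) ∧
    (1 < α + β → β < 1 →
      ∃ C : ℝ, ∀ᶠ n : ℕ in atTop,
        eLpNorm (fun x => Vilenkin.T m q f n x - f x) p (Vilenkin.μ m) ≤
          ENNReal.ofReal (C * (n : ℝ) ^ (-(1 - β)))) ∧
    (β = 1 →
      ∃ C : ℝ, ∀ᶠ n : ℕ in atTop,
        eLpNorm (fun x => Vilenkin.T m q f n x - f x) p (Vilenkin.μ m) ≤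
          ENNReal.ofReal (C * (Real.log n)⁻¹)) := by
  obtain ⟨c, C, hc, hC, hcC⟩ := hq_anti.exists_rpow_bounds hq_nonneg hβ_pos hq
  obtain ⟨A, hA, hsum⟩ := hf.exists_eLpNorm_sum_le hm hbdd hq_nonneg hq_anti hC
    (fun k hk => (hcC k hk).2) hα hp_one hp_top
  have hM0 : Vilenkin.M m 0 = 1 := rfl
  have hM2 : ∀ j, 2 * Vilenkin.M m j ≤ Vilenkin.M m (j + 1) := fun j =>
    Nat.mul_le_mul_right _ (hm j)
  have hblock : ∀ n : ℕ, 1 ≤ n → ∃ J, Vilenkin.M m J ≤ n ∧ n < Vilenkin.M m (J + 1) :=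
    fun n hn => exists_le_and_lt_succ (Vilenkin.lt_M hm) hM0 hn
  -- it suffices to bound the weighted sums and to bound `Q_n` from below
  have reduce : ∀ n : ℕ, 1 ≤ n → ∀ L X Y : ℝ, 0 < L → L ≤ ∑ k ∈ Finset.range n, q k →
      (∀ J, Vilenkin.M m J ≤ n →
        ∑ j ∈ Finset.range (J + 1), (Vilenkin.M m j : ℝ) ^ (1 - α - β) ≤ X) →
      A * (1 + X) / L ≤ Y →
      eLpNorm (fun x => Vilenkin.T m q f n x - f x) p (Vilenkin.μ m) ≤ ENNReal.ofReal Y := by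
    intro n hn L X Y hL hLQ hX hY
    obtain ⟨J, h1, h2⟩ := hblock n hn
    refine (Vilenkin.eLpNorm_T_sub_le (hL.trans_le hLQ) (hsum n J h1 h2.le)).trans
      (ENNReal.ofReal_le_ofReal (le_trans ?_ hY))
    have h0 : 0 ≤ ∑ j ∈ Finset.range (J + 1), (Vilenkin.M m j : ℝ) ^ (1 - α - β) :=
      Finset.sum_nonneg fun j _ => by positivity
    have h3 := hX J h1
    have h4 : 0 ≤ X := h0.trans h3
    gcongr
  have hQ : ∀ n : ℕ, 1 ≤ n → c * (n : ℝ) ^ (1 - β) ≤ ∑ k ∈ Finset.range n, q k :=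
    fun n hn => hq_anti.mul_rpow_le_sum_range hn (hcC n hn).1
  refine ⟨fun h => ?_, fun h => ?_, fun h hβ1 => ?_, fun h => ?_⟩
  · have hγ : 0 < 1 - α - β := by linarith
    set K : ℝ := 2 ^ (1 - α - β) / (2 ^ (1 - α - β) - 1) with hK
    have hK0 : 0 ≤ K :=
      div_nonneg (by positivity) (sub_nonneg.2 (Real.one_le_rpow one_le_two hγ.le))
    refine ⟨A * (1 + K) / c, eventually_atTop.2 ⟨1, fun n hn => ?_⟩⟩
    have hn1 : (1 : ℝ) ≤ n := by exact_mod_cast hn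
    have hn0 : (0 : ℝ) < n := by linarith
    refine reduce n hn _ (K * (n : ℝ) ^ (1 - α - β)) _ (by positivity) (hQ n hn)
      (fun J hJ => (sum_rpow_le_of_pos hM0 hM2 hγ J).trans ?_) ?_
    · gcongr
    · have h1 : (1 : ℝ) ≤ (n : ℝ) ^ (1 - α - β) := Real.one_le_rpow hn1 hγ.le
      have h2 : (n : ℝ) ^ (1 - α - β) = (n : ℝ) ^ (-α) * (n : ℝ) ^ (1 - β) := by
        rw [← Real.rpow_add hn0]; congr 1; ring
      calc _ ≤ A * ((n : ℝ) ^ (1 - α - β) + K * (n : ℝ) ^ (1 - α - β)) /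
            (c * (n : ℝ) ^ (1 - β)) := by gcongr
        _ = _ := by rw [h2]; field_simp
  · have hγ : 1 - α - β = 0 := by linarith
    have hl2 : 0 < Real.log 2 := Real.log_pos one_lt_two
    -- Every block contributes $1$, and $J+1\le1+\log n/\log2$ blocks meet $[1,n]$.
    refine ⟨A * (2 + (Real.log 2)⁻¹) / c, eventually_atTop.2 ⟨1, fun n hn => ?_⟩⟩
    have hn1 : (1 : ℝ) ≤ n := by exact_mod_cast hn
    have hn0 : (0 : ℝ) < n := by linarith
    have hlog : 0 ≤ Real.log n := Real.log_nonneg hn1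
    refine reduce n hn _ (1 + Real.log n / Real.log 2) _ (by positivity) (hQ n hn)
      (fun J hJ => ?_) ?_
    · have := natCast_le_log_div_log_two hM0 hM2 hJ
      simp only [hγ, Real.rpow_zero, Finset.sum_const, Finset.card_range, nsmul_eq_mul, mul_one]
      push_cast
      linarith
    · have h2 : -α = -(1 - β) := by linarith
      rw [h2, Real.rpow_neg hn0.le, div_eq_mul_inv, mul_inv]
      set w := ((n : ℝ) ^ (1 - β))⁻¹
      have hw : 0 ≤ w := by positivity
      have h3 : 1 + (1 + Real.log n / Real.log 2) ≤
          (2 + (Real.log 2)⁻¹) * (Real.log n + 1) := by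
        rw [div_eq_mul_inv]
        nlinarith [inv_pos.2 hl2]
      calc _ ≤ A * ((2 + (Real.log 2)⁻¹) * (Real.log n + 1)) * (c⁻¹ * w) := by gcongr
        _ = _ := by ring
  · have hγ : 1 - α - β < 0 := by linarith
    refine ⟨A * (1 + (1 - 2 ^ (1 - α - β))⁻¹) / c, eventually_atTop.2 ⟨1, fun n hn => ?_⟩⟩
    have hn0 : (0 : ℝ) < n := by exact_mod_cast hn
    refine reduce n hn _ _ _ (by positivity) (hQ n hn)
      (fun J _ => sum_rpow_le_of_neg hM0 hM2 hγ (J + 1)) (le_of_eq ?_)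
    rw [Real.rpow_neg hn0.le]
    field_simp
  · have hγ : 1 - α - β < 0 := by linarith
    -- The block sum is bounded as in the previous case, but $Q_n$ is now compared with $\log n$,
    -- which is positive only from $n=2$ on.
    refine ⟨A * (1 + (1 - 2 ^ (1 - α - β))⁻¹) / c, eventually_atTop.2 ⟨2, fun n hn => ?_⟩⟩
    have hlog : 0 < Real.log n := Real.log_pos (by exact_mod_cast hn)
    refine reduce n (by omega) (c * Real.log n) _ _ (by positivity)
      (mul_log_le_sum_range hq_nonneg hc.le (fun k hk => ?_) (by omega))
      (fun J _ => sum_rpow_le_of_neg hM0 hM2 hγ (J + 1)) (le_of_eq ?_)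
    · simpa [h, Real.rpow_neg_one] using (hcC k hk).1
    · field_simp
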